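/- Let $\Gamma$ be a countable discrete group which is residually finite and amenable, and let $f=\sum_\gamma f_\gamma\gamma\in\mathbb{Z}\Gamma$. Put $\mathbb{T}=\mathbb{R}/\mathbb{Z}$ and let $$X_f=\Bigl\{x\in\mathbb{T}^\Gamma:\ \sum_{\gamma'\in\Gamma}f_{\gamma'}x_{\gamma\gamma'}=0\ \text{ for every }\gamma\in\Gamma\Bigr\},$$ a compact abelian group, with the action $\alpha_f$ of $\Gamma$ by the continuous automorphisms $(\alpha_f^\gamma x)_{\gamma'}=x_{\gamma^{-1}\gamma'}$. Suppose that $X_f\neq 0$ and that $\alpha_f$ is expansive, i.e. that $\bigcap_{\gamma\in\Gamma}\alpha_f^\gamma(U)=\{0\}$ for some open neighbourhood $U$ of $0$ in $X_f$. Then the topological entropy $h(\alpha_f)$ is strictly positive. More precisely, let $(\Gamma_n)$ be any sequence of normal subgroups of finite index in $\Gamma$ with $\lim_{n\to\infty}\Gamma_n=\{1\}$, i.e. such that for every finite $K\subset\Gamma$ one has $\Gamma_n\cap K^{-1}K\subset\{1\}$ for all sufficiently large $n$ (for instance, any decreasing sequence of finite index normal subgroups with trivial intersection). Then $$h(\alpha_f)\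 \ge\ |\Gamma/\Gamma_n|^{-1}\log 2\qquad\text{for all sufficiently large } n.$$ Here $h(\alpha_f)=\sup_U\lim_Q |Q|^{-1}\log s(Q,U)$, where $U$ runs over the neighbourhoods of $0$ in $X_f$, $s(Q,U)$ is the maximal cardinality of a set $S\subset X_f$ such that any two distinct $x,y\in S$ satisfy $\alpha_f^\gamma x-\alpha_f^\gamma y\notin U$ for some $\gamma\in Q$, and the limit (taken as a lower limit) is along nonempty finite sets $Q\subset\Gamma$ which become more and more left invariant, i.e. for which $\sum_{\gamma\in K}|\gamma Q\,\triangle\,Q|/|Q|$ tends to $0$ for every finite $K\subset\Gamma$. -/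

import Mathlib

open Filter Topology
open scoped Pointwise symmDiff

noncomputable section

namespace AlgAct

/-! ### Amenable groups and Følner sets -/

/-- A finite (nonempty) set `Q ⊆ Γ` is left `(K, ε)`-invariant if
`∑_{γ ∈ K} |γQ ∆ Q| / |Q| < ε`. -/
def IsLeftInvariant {Γ : Type*} [Group Γ] (K : Finset Γ) (ε : ℝ) (Q : Finset Γ) : Prop :=
  Q.Nonempty ∧
    ∑ γ ∈ K, (((γ • (Q : Set Γ)) ∆ (Q : Set Γ)).ncard : ℝ) / (Q.card : ℝ) < ε

/-- A left Følner sequence of finite subsets of `Γ`. -/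
def IsLeftFolner {Γ : Type*} [Group Γ] (Q : ℕ → Finset Γ) : Prop :=
  ∀ (K : Finset Γ) (ε : ℝ), 0 < ε → ∃ N : ℕ, ∀ n ≥ N, IsLeftInvariant K ε (Q n)

/-- A (countable discrete) group is amenable if it has a left Følner sequence. -/
def IsAmenable (Γ : Type*) [Group Γ] : Prop :=
  ∃ Q : ℕ → Finset Γ, IsLeftFolner Q

/-- The filter of finite subsets of `Γ` that become more and more left invariant; a sequence of
finite sets converges to this filter if and only if it is a left Følner sequence. -/
def folnerFilter (Γ : Type*) [Group Γ] : Filter (Finset Γ) :=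
  ⨅ (K : Finset Γ) (ε : ℝ) (_ : 0 < ε), 𝓟 {Q | IsLeftInvariant K ε Q}

theorem tendsto_folnerFilter_iff {Γ : Type*} [Group Γ] (Q : ℕ → Finset Γ) :
    Tendsto Q atTop (folnerFilter Γ) ↔ IsLeftFolner Q := by
  simp [folnerFilter, IsLeftFolner, tendsto_iInf, tendsto_principal]

/-- `lim Γₙ = {1}`: for every finite `K ⊆ Γ` one has `Γₙ ∩ K⁻¹K ⊆ {1}` for all large `n`. -/
def TendsToTrivial {Γ : Type*} [Group Γ] (G : ℕ → Subgroup Γ) : Prop :=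
  ∀ K : Finset Γ, ∃ N : ℕ, ∀ n ≥ N, (G n : Set Γ) ∩ ((K : Set Γ)⁻¹ * (K : Set Γ)) ⊆ {1}

/-! ### Algebraic actions, expansiveness, entropy -/

/-- An algebraic `Γ`-action on a compact abelian group `X`: a homomorphism from `Γ` to the group of
continuous automorphisms of `X` (the inverse of `act γ` is `act γ⁻¹`, hence continuous too). -/
structure AlgebraicAction (Γ X : Type*) [Group Γ] [AddCommGroup X] [TopologicalSpace X]
    [IsTopologicalAddGroup X] [CompactSpace X] [T2Space X] where
  act : Γ → X ≃+ X
  map_one : ∀ x : X, act 1 x = x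
  map_mul : ∀ (γ δ : Γ) (x : X), act (γ * δ) x = act γ (act δ x)
  continuous_act : ∀ γ : Γ, Continuous fun x : X => act γ x

section Actions

variable {Γ X : Type*} [Group Γ] [AddCommGroup X] [TopologicalSpace X]
  [IsTopologicalAddGroup X] [CompactSpace X] [T2Space X]

/-- `α` is expansive if `⋂_γ α^γ(U) = 0` for some open neighbourhood `U` of `0`. -/
def IsExpansive (α : AlgebraicAction Γ X) : Prop :=
  ∃ U : Set X, IsOpen U ∧ (0 : X) ∈ U ∧ ⋂ γ : Γ, (α.act γ) '' U = {0}

/-- `S ⊆ X` is `(Q, U)`-separated: any two distinct points `x, y` of `S` satisfy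
`α^γ x - α^γ y ∉ U` for some `γ ∈ Q`. -/
def IsSeparated (α : AlgebraicAction Γ X) (Q : Finset Γ) (U : Set X) (S : Set X) : Prop :=
  S.Pairwise fun x y => ∃ γ ∈ Q, α.act γ x - α.act γ y ∉ U

/-- The maximal cardinality of a `(Q, U)`-separated set (finite if `U` is a neighbourhood of `0`,
by compactness). -/
def sepNumber (α : AlgebraicAction Γ X) (Q : Finset Γ) (U : Set X) : ℕ∞ :=
  ⨆ (S : Set X) (_ : IsSeparated α Q U S), S.encard

/-- The exponential growth rate `lim_Q |Q|⁻¹ log sepNumber(Q, U)` along Følner sets. It is taken as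
a lower limit, which is the smallest of the usual choices; all of them give the same supremum
over `U` when `Γ` is amenable. -/
def sepEntropy (α : AlgebraicAction Γ X) (U : Set X) : EReal :=
  liminf (fun Q : Finset Γ => ENNReal.log ((sepNumber α Q U : ℕ∞) : ENNReal) / (Q.card : EReal))
    (folnerFilter Γ)

/-- The topological entropy `h(α)` (Bowen's definition through separated sets, with respect to the
group uniformity of `X`) of an algebraic action `α` of an amenable group. -/
def entropy (α : AlgebraicAction Γ X) : EReal :=
  ⨆ U ∈ 𝓝 (0 : X), sepEntropy α U

end Actions

/-! ### The action `α_f` on `X_f` -/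

section Principal

variable {Γ : Type*} [Group Γ]

/-- `ρ_f : 𝕋^Γ → 𝕋^Γ`, `(ρ_f x)_γ = ∑_γ' f_γ' x_{γγ'}`, with `𝕋 = ℝ/ℤ`. -/
def rho (f : MonoidAlgebra ℤ Γ) : (Γ → UnitAddCircle) →+ (Γ → UnitAddCircle) where
  toFun x := fun γ => ∑ γ' ∈ f.coeff.support, f.coeff γ' • x (γ * γ')
  map_zero' := by ext; simp
  map_add' x y := by ext; simp [smul_add, Finset.sum_add_distrib]

theorem continuous_rho (f : MonoidAlgebra ℤ Γ) : Continuous (rho f) := by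
  change Continuous fun (x : Γ → UnitAddCircle) γ =>
    ∑ γ' ∈ f.coeff.support, f.coeff γ' • x (γ * γ')
  fun_prop

/-- `X_f = ker ρ_f`, a closed subgroup of `𝕋^Γ`. -/
def X (f : MonoidAlgebra ℤ Γ) : AddSubgroup (Γ → UnitAddCircle) := (rho f).ker

theorem mem_X_iff (f : MonoidAlgebra ℤ Γ) (x : Γ → UnitAddCircle) :
    x ∈ X f ↔ ∀ γ, ∑ γ' ∈ f.coeff.support, f.coeff γ' • x (γ * γ') = 0 :=
  funext_iff

instance (f : MonoidAlgebra ℤ Γ) : CompactSpace (X f) :=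
  isCompact_iff_compactSpace.mp
    (IsClosed.isCompact (isClosed_singleton.preimage (continuous_rho f)))

/-- The automorphism `λ^γ` of `X_f`, `(λ^γ x)_γ' = x_{γ⁻¹γ'}`. -/
def shift (f : MonoidAlgebra ℤ Γ) (γ : Γ) : X f ≃+ X f where
  toFun x := ⟨fun γ' => x.1 (γ⁻¹ * γ'), by
    rw [mem_X_iff]
    intro δ
    simpa [mul_assoc] using (mem_X_iff f x.1).1 x.2 (γ⁻¹ * δ)⟩
  invFun x := ⟨fun γ' => x.1 (γ * γ'), by
    rw [mem_X_iff]
    intro δ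
    simpa [mul_assoc] using (mem_X_iff f x.1).1 x.2 (γ * δ)⟩
  left_inv x := by ext; simp
  right_inv x := by ext; simp
  map_add' x y := by ext; simp

/-- The algebraic `Γ`-action `α_f = λ|_{X_f}` on `X_f`. -/
def alpha (f : MonoidAlgebra ℤ Γ) : AlgebraicAction Γ (X f) where
  act := shift f
  map_one x := by ext; simp [shift]
  map_mul γ δ x := by ext; simp [shift, mul_assoc]
  continuous_act γ := by
    refine Continuous.subtype_mk ?_ _
    exact continuous_pi fun γ' =>
      (continuous_apply (γ⁻¹ * γ')).comp continuous_subtype_val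

end Principal

end AlgAct

end

namespace AlgAct

noncomputable section

/-! Expansiveness makes `ρ_f` injective on bounded real functions, since a small multiple of a
bounded annihilator would give a point of `X_f` whose whole orbit stays near `0`. This makes `f`
invertible in `ℓ¹(Γ)`. Hahn-Banach and a Neumann series show that `v ↦ v * f` is onto. It is
injective because `ρ_f` is bijective on functions on finite quotients, and residual finiteness lets
such functions isolate a coefficient of `v` up to a small tail.

If the inverse `w` were integer valued, it would lie in `ℤΓ` and force `X_f = 0`. So some
coefficient of `w` is not an integer, and `w` mod 1, reflected and translated, is a point `x` of
`X_f` with `x_1 ≠ 0` and a lift in `ℓ¹`.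

Summability makes far apart translates of `x` nearly independent: the sums over subsets of a sparse
`D ⊆ Q` are `2^|D|` separated points, and `D` can fill a fixed proportion of `Q`. Hence `h(α_f) ≥ c
> 0`. For infinite `Γ` the indices tend to infinity, so `c` eventually exceeds the stated bound;
finite `Γ` is treated directly. -/

/-- The Banach space `ℓ¹(Γ, ℝ)`. -/
abbrev EllOne (Γ : Type*) : Type _ := lp (fun _ : Γ => ℝ) 1

/-! ### Preliminaries on `ℓ¹(Γ)`. -/

section EllOne

variable {Γ : Type*}

theorem EllOne.summable_abs (v : EllOne Γ) : Summable fun γ => |v γ| := by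
  simpa using (lp.memℓp v).summable

theorem EllOne.summable (v : EllOne Γ) : Summable fun γ => v γ :=
  v.summable_abs.of_abs

theorem EllOne.norm_eq (v : EllOne Γ) : ‖v‖ = ∑' γ, |v γ| := by
  simp [lp.norm_eq_tsum_rpow (p := 1) (by simp) v]

theorem EllOne.exists_tail_lt (v : EllOne Γ) (γ₀ : Γ) {ε : ℝ} (hε : 0 < ε) :
    ∃ F : Finset Γ, γ₀ ∈ F ∧ ∑' γ : {γ // γ ∉ F}, |v γ| < ε := by
  have h := (tendsto_tsum_compl_atTop_zero fun γ => |v γ|).eventually (gt_mem_nhds hε)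
  obtain ⟨F, hF, hγ⟩ := (h.and (eventually_ge_atTop {γ₀})).exists
  exact ⟨F, by simpa using hγ, hF⟩

/-- Precomposition with a permutation `e` of `Γ`, as an operator on `ℓ¹(Γ)`. -/
def reindex (e : Equiv.Perm Γ) : EllOne Γ →L[ℝ] EllOne Γ :=
  LinearMap.mkContinuous
    { toFun := fun v => ⟨fun γ => v (e γ), memℓp_gen (by
        simpa [Function.comp_def] using (e.summable_iff (f := fun γ => |v γ|)).2 v.summable_abs)⟩
      map_add' := fun _ _ => rfl
      map_smul' := fun _ _ => rfl } 1 (fun v => by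
        rw [one_mul, EllOne.norm_eq, EllOne.norm_eq]
        exact (e.tsum_eq fun γ => |v γ|).le)

@[simp]
theorem reindex_apply (e : Equiv.Perm Γ) (v : EllOne Γ) (γ : Γ) : reindex e v γ = v (e γ) := rfl

theorem norm_reindex (e : Equiv.Perm Γ) (v : EllOne Γ) : ‖reindex e v‖ = ‖v‖ := by
  rw [EllOne.norm_eq, EllOne.norm_eq]
  exact e.tsum_eq fun γ => |v γ|

/-- A bounded operator on `ℓ¹(Γ)` is bounded by its values at the basis vectors. -/
theorem opNorm_le_of_basis [DecidableEq Γ] (A : EllOne Γ →L[ℝ] EllOne Γ) {c : ℝ} (hc : 0 ≤ c)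
    (h : ∀ γ, ‖A (lp.single 1 γ 1)‖ ≤ c) : ‖A‖ ≤ c := by
  refine A.opNorm_le_bound hc fun v => ?_
  have hv : HasSum (fun γ => A (lp.single 1 γ (v γ))) (A v) :=
    (lp.hasSum_single (by simp) v).mapL A
  have hle : ∀ γ, ‖A (lp.single 1 γ (v γ))‖ ≤ c * |v γ| := fun γ => by
    have : lp.single (E := fun _ : Γ => ℝ) 1 γ (v γ) = v γ • lp.single 1 γ 1 := by
      rw [← lp.single_smul]; simp
    rw [this, map_smul, norm_smul, Real.norm_eq_abs, mul_comm]
    gcongr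
    exact h γ
  rw [← hv.tsum_eq, EllOne.norm_eq v, ← tsum_mul_left]
  exact tsum_of_norm_bounded (v.summable_abs.mul_left c).hasSum hle

/-- A point outside a closed subspace is separated from it by a functional vanishing there. -/
theorem exists_dual_eq_zero_of_notMem {E : Type*} [NormedAddCommGroup E] [NormedSpace ℝ E]
    (p : Submodule ℝ E) (hp : IsClosed (p : Set E)) {x : E} (hx : x ∉ p) :
    ∃ φ : E →L[ℝ] ℝ, (∀ z ∈ p, φ z = 0) ∧ φ x ≠ 0 := by
  have : IsClosed (p : Set E) := hp
  obtain ⟨g, -, hg⟩ := exists_dual_vector ℝ (p.mkQ x) (by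
    rw [norm_ne_zero_iff]
    simpa using hx)
  refine ⟨g.comp p.mkQL, fun z hz => ?_, ?_⟩
  · have : p.mkQ z = 0 := by simpa using hz
    change g (p.mkQ z) = 0
    rw [this, map_zero]
  · change g (p.mkQ x) ≠ 0
    rw [hg]
    simpa using hx

end EllOne

/-! ### Convolution by `f` on `ℓ¹(Γ)`: surjectivity and injectivity. -/

section Convolution

variable {Γ : Type*} [Group Γ]

/-- Left translation `(λ_γ v)_δ = v_{γ⁻¹δ}` on `ℓ¹(Γ)`. -/
def ltrans (γ : Γ) : EllOne Γ →L[ℝ] EllOne Γ := reindex (Equiv.mulLeft γ⁻¹)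

/-- Right translation `(v γ)_δ = v_{δγ⁻¹}` on `ℓ¹(Γ)`. -/
def rtrans (γ : Γ) : EllOne Γ →L[ℝ] EllOne Γ := reindex (Equiv.mulRight γ⁻¹)

@[simp]
theorem ltrans_apply (γ δ : Γ) (v : EllOne Γ) : ltrans γ v δ = v (γ⁻¹ * δ) := rfl

@[simp]
theorem rtrans_apply (γ δ : Γ) (v : EllOne Γ) : rtrans γ v δ = v (δ * γ⁻¹) := rfl

theorem ltrans_rtrans (γ δ : Γ) (v : EllOne Γ) :
    ltrans γ (rtrans δ v) = rtrans δ (ltrans γ v) := by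
  ext η
  simp [mul_assoc]

theorem ltrans_single [DecidableEq Γ] (γ δ : Γ) (c : ℝ) :
    ltrans γ (lp.single 1 δ c) = lp.single 1 (γ * δ) c := by
  ext η
  simp [lp.single_apply, Pi.single_apply, inv_mul_eq_iff_eq_mul]

theorem rtrans_single [DecidableEq Γ] (γ δ : Γ) (c : ℝ) :
    rtrans γ (lp.single 1 δ c) = lp.single 1 (δ * γ) c := by
  ext η
  simp [lp.single_apply, Pi.single_apply, mul_inv_eq_iff_eq_mul]

/-- Right convolution `v ↦ v * f` on `ℓ¹(Γ)`. -/
def rconv (f : MonoidAlgebra ℤ Γ) : EllOne Γ →L[ℝ] EllOne Γ :=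
  ∑ γ ∈ f.coeff.support, (f.coeff γ : ℝ) • rtrans γ

/-- Left convolution `v ↦ f * v` on `ℓ¹(Γ)`. -/
def lconv (f : MonoidAlgebra ℤ Γ) : EllOne Γ →L[ℝ] EllOne Γ :=
  ∑ γ ∈ f.coeff.support, (f.coeff γ : ℝ) • ltrans γ

theorem rconv_eq (f : MonoidAlgebra ℤ Γ) (v : EllOne Γ) :
    rconv f v = ∑ γ ∈ f.coeff.support, (f.coeff γ : ℝ) • rtrans γ v := by
  simp [rconv]

theorem lconv_eq (f : MonoidAlgebra ℤ Γ) (v : EllOne Γ) :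
    lconv f v = ∑ γ ∈ f.coeff.support, (f.coeff γ : ℝ) • ltrans γ v := by
  simp [lconv]

theorem rconv_apply (f : MonoidAlgebra ℤ Γ) (v : EllOne Γ) (δ : Γ) :
    rconv f v δ = ∑ γ ∈ f.coeff.support, (f.coeff γ : ℝ) * v (δ * γ⁻¹) := by
  rw [rconv_eq, lp.coeFn_sum, Finset.sum_apply]
  rfl

theorem lconv_apply (f : MonoidAlgebra ℤ Γ) (v : EllOne Γ) (δ : Γ) :
    lconv f v δ = ∑ γ ∈ f.coeff.support, (f.coeff γ : ℝ) * v (γ⁻¹ * δ) := by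
  rw [lconv_eq, lp.coeFn_sum, Finset.sum_apply]
  rfl

theorem ltrans_rconv (f : MonoidAlgebra ℤ Γ) (γ : Γ) (v : EllOne Γ) :
    ltrans γ (rconv f v) = rconv f (ltrans γ v) := by
  simp [rconv_eq, ltrans_rtrans]

theorem lconv_rconv (f g : MonoidAlgebra ℤ Γ) (v : EllOne Γ) :
    lconv f (rconv g v) = rconv g (lconv f v) := by
  rw [lconv_eq, lconv_eq, map_sum]
  simp [ltrans_rconv]

theorem lconv_single_one [DecidableEq Γ] (f : MonoidAlgebra ℤ Γ) :
    lconv f (lp.single 1 1 1) = rconv f (lp.single 1 1 1) := by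
  simp [lconv_eq, rconv_eq, ltrans_single, rtrans_single]

/-- The pairing of `ℓ¹(Γ)` with bounded functions intertwines `v ↦ v * f` with `ρ_f`. -/
theorem tsum_rconv_mul (f : MonoidAlgebra ℤ Γ) (v : EllOne Γ) (y : Γ → ℝ) (M : ℝ)
    (hy : ∀ γ, |y γ| ≤ M) :
    ∑' γ, rconv f v γ * y γ =
      ∑' γ, v γ * ∑ γ' ∈ f.coeff.support, (f.coeff γ' : ℝ) * y (γ * γ') := by
  have hs : ∀ γ', Summable fun γ => v γ * y (γ * γ') := fun γ' => by
    refine Summable.of_norm_bounded (g := fun γ => |v γ| * M) (v.summable_abs.mul_right M)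
      fun γ => ?_
    rw [norm_mul, Real.norm_eq_abs, Real.norm_eq_abs]
    gcongr
    exact hy _
  have he : ∀ γ', HasSum (fun γ => v (γ * γ'⁻¹) * y γ) (∑' γ, v γ * y (γ * γ')) := fun γ' => by
    rw [← (Equiv.mulRight γ').hasSum_iff]
    simpa [Function.comp_def] using (hs γ').hasSum
  have h1 := hasSum_sum fun γ' (_ : γ' ∈ f.coeff.support) => (he γ').mul_left (f.coeff γ' : ℝ)
  have h2 := hasSum_sum fun γ' (_ : γ' ∈ f.coeff.support) =>
    (hs γ').hasSum.mul_left (f.coeff γ' : ℝ)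
  have e1 : (fun γ => rconv f v γ * y γ) =
      fun γ => ∑ γ' ∈ f.coeff.support, (f.coeff γ' : ℝ) * (v (γ * γ'⁻¹) * y γ) := by
    funext γ
    rw [rconv_apply, Finset.sum_mul]
    simp only [mul_assoc]
  have e2 : (fun γ => v γ * ∑ γ' ∈ f.coeff.support, (f.coeff γ' : ℝ) * y (γ * γ')) =
      fun γ => ∑ γ' ∈ f.coeff.support, (f.coeff γ' : ℝ) * (v γ * y (γ * γ')) := by
    funext γ
    rw [Finset.mul_sum]
    exact Finset.sum_congr rfl fun _ _ => by ring
  rw [e1, e2, h1.tsum_eq, h2.tsum_eq]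

/-- `f` has no nonzero bounded real annihilator: `ρ_f` is injective on `ℓ^∞(Γ, ℝ)`. -/
def BoundedInjective (f : MonoidAlgebra ℤ Γ) : Prop :=
  ∀ (y : Γ → ℝ) (M : ℝ), (∀ γ, |y γ| ≤ M) →
    (∀ γ, ∑ γ' ∈ f.coeff.support, (f.coeff γ' : ℝ) * y (γ * γ') = 0) → y = 0

/-- If `ρ_f` is injective on bounded functions, then `v ↦ v * f` is onto on `ℓ¹(Γ)`. -/
theorem BoundedInjective.rconv_surjective {f : MonoidAlgebra ℤ Γ} (hf : BoundedInjective f) :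
    Function.Surjective (rconv f) := by
  classical
  let b : Γ → EllOne Γ := fun γ => lp.single 1 γ 1
  have hb : ∀ γ, ‖b γ‖ = 1 := fun γ => by simp [b, lp.norm_single]
  let p : Submodule ℝ (EllOne Γ) := (Submodule.span ℝ (Set.range (rconv f ∘ b))).topologicalClosure
  -- A functional vanishing on all translates of `f` is a bounded function killed by `ρ_f`, hence
  -- zero.
  have hp : b 1 ∈ p := by
    by_contra hx
    obtain ⟨φ, hφ, hφx⟩ := exists_dual_eq_zero_of_notMem p
      (Submodule.isClosed_topologicalClosure _) hx
    refine hφx (congrFun (hf (fun γ => φ (b γ)) ‖φ‖ (fun γ => ?_) fun γ => ?_) 1)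
    · simpa [hb] using φ.le_opNorm (b γ)
    · have := hφ (rconv f (b γ))
        (Submodule.le_topologicalClosure _ (Submodule.subset_span ⟨γ, rfl⟩))
      simpa [rconv_eq, b, rtrans_single] using this
  obtain ⟨u, hu, hd⟩ := Metric.mem_closure_iff.1 hp (1 / 2) (by norm_num)
  obtain ⟨c, hc⟩ := (Finsupp.mem_span_range_iff_exists_finsupp).1 hu
  -- `S` is right convolution by `c`, so `rconv f ∘ S` is right convolution by `u`, which is within
  -- `1/2` of the identity and therefore invertible.
  let S : EllOne Γ →L[ℝ] EllOne Γ := ∑ γ ∈ c.support, c γ • rtrans γ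
  have hS : ∀ γ, rconv f (S (b γ)) = ltrans γ u := fun γ => by
    rw [← hc]
    simp [S, Finsupp.sum, ltrans_rconv, b, rtrans_single,
      ltrans_single]
  have hE : ‖1 - (rconv f).comp S‖ < 1 := by
    refine (opNorm_le_of_basis _ (c := 1 / 2) (by norm_num) fun γ => ?_).trans_lt (by norm_num)
    have : (1 - (rconv f).comp S) (b γ) = ltrans γ (b 1 - u) := by
      rw [map_sub, ← hS]
      simp [b, ltrans_single]
    change ‖(1 - (rconv f).comp S) (b γ)‖ ≤ _
    rw [this, ltrans, norm_reindex, ← dist_eq_norm]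
    exact hd.le
  have hU := isUnit_one_sub_of_norm_lt_one hE
  rw [sub_sub_cancel] at hU
  obtain ⟨w, hw⟩ := hU.exists_right_inv
  intro v
  refine ⟨S (w v), ?_⟩
  exact congrArg (fun A : EllOne Γ →L[ℝ] EllOne Γ => A v) hw

/-- In a residually finite group, finitely many elements can be separated from a given one in a
finite quotient. -/
theorem exists_finiteIndex_separating [Group.ResiduallyFinite Γ] (F : Finset Γ) (γ₀ : Γ) :
    ∃ N : FiniteIndexNormalSubgroup Γ, ∀ γ ∈ F, γ₀⁻¹ * γ ∈ N → γ = γ₀ := by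
  classical
  induction F using Finset.induction_on with
  | empty => exact ⟨⟨⊤, inferInstance, inferInstance⟩, by simp⟩
  | insert a F _ ih =>
    obtain ⟨N, hN⟩ := ih
    by_cases ha : a = γ₀
    · refine ⟨N, fun γ hγ h => ?_⟩
      rcases Finset.mem_insert.1 hγ with rfl | hγ
      exacts [ha, hN γ hγ h]
    · obtain ⟨H, hH⟩ := Group.exists_finiteIndexNormalSubgroup_notMem (γ₀⁻¹ * a)
        (fun h => ha (inv_mul_eq_one.1 h).symm)
      refine ⟨N ⊓ H, fun γ hγ h => ?_⟩
      have h' : γ₀⁻¹ * γ ∈ N ∧ γ₀⁻¹ * γ ∈ H := h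
      rcases Finset.mem_insert.1 hγ with rfl | hγ
      exacts [absurd h'.2 hH, hN γ hγ h'.1]

/-- If `ρ_f` is injective on bounded functions, then every function on a finite quotient is of the
form `ρ_f Y`. -/
theorem BoundedInjective.exists_quotient_preimage {f : MonoidAlgebra ℤ Γ}
    (hf : BoundedInjective f) (N : Subgroup Γ) [N.Normal] [N.FiniteIndex] (z : Γ ⧸ N → ℝ) :
    ∃ Y : Γ ⧸ N → ℝ, ∀ c : Γ ⧸ N, ∑ γ' ∈ f.coeff.support, (f.coeff γ' : ℝ) * Y (c * γ') = z c := by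
  let T : (Γ ⧸ N → ℝ) →ₗ[ℝ] (Γ ⧸ N → ℝ) :=
    { toFun := fun Y c => ∑ γ' ∈ f.coeff.support, (f.coeff γ' : ℝ) * Y (c * γ')
      map_add' := fun Y Z => by ext c; simp [mul_add, Finset.sum_add_distrib]
      map_smul' := fun t Y => by
        ext c
        simp only [Pi.smul_apply, smul_eq_mul, RingHom.id_apply, Finset.mul_sum]
        exact Finset.sum_congr rfl fun _ _ => by ring }
  -- A function on the finite quotient lifts to a bounded periodic function on `Γ`. In finite
  -- dimension injectivity then gives surjectivity.
  have hT : Function.Injective T := by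
    rw [injective_iff_map_eq_zero]
    intro Y hY
    obtain ⟨M, hM⟩ := (Set.finite_range fun c => |Y c|).bddAbove
    have := hf (fun γ => Y γ) M (fun γ => hM ⟨_, rfl⟩) (fun γ => congrFun hY (γ : Γ ⧸ N))
    ext c
    obtain ⟨γ, rfl⟩ := QuotientGroup.mk_surjective c
    exact congrFun this γ
  obtain ⟨Y, hY⟩ := LinearMap.injective_iff_surjective.1 hT z
  exact ⟨Y, congrFun hY⟩

/-- If `Γ` is residually finite and `ρ_f` is injective on bounded functions, then `v ↦ v * f` is
injective on `ℓ¹(Γ)`. -/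
theorem BoundedInjective.eq_zero_of_rconv_eq_zero [Group.ResiduallyFinite Γ]
    {f : MonoidAlgebra ℤ Γ} (hf : BoundedInjective f) {v : EllOne Γ} (hv : rconv f v = 0) :
    v = 0 := by
  classical
  ext γ₀
  by_contra hne
  have hpos : 0 < |v γ₀| := abs_pos.2 hne
  obtain ⟨F, hγ₀, hF⟩ := v.exists_tail_lt γ₀ hpos
  obtain ⟨N, hN⟩ := exists_finiteIndex_separating F γ₀
  -- Pairing `v * f = 0` with `Y` shows that `v` sums to zero over the coset `γ₀N`. That coset meets
  -- `F` only in `γ₀`, so the sum differs from `v γ₀` by less than `|v γ₀|`.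
  obtain ⟨Y, hY⟩ := hf.exists_quotient_preimage N.toSubgroup
    (Pi.single (γ₀ : Γ ⧸ N.toSubgroup) 1)
  obtain ⟨M, hM⟩ := (Set.finite_range fun c => |Y c|).bddAbove
  have key := tsum_rconv_mul f v (fun γ => Y γ) M fun γ => hM ⟨_, rfl⟩
  let χ : Γ → ℝ := fun γ => (Pi.single (γ₀ : Γ ⧸ N.toSubgroup) 1 : Γ ⧸ N.toSubgroup → ℝ) γ
  have hχ : ∀ γ, |v γ * χ γ| ≤ |v γ| := fun γ => by
    by_cases h : (γ : Γ ⧸ N.toSubgroup) = γ₀ <;> simp [χ, Pi.single_apply, h]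
  have hg : Summable fun γ => |v γ * χ γ| :=
    Summable.of_nonneg_of_le (fun _ => abs_nonneg _) hχ v.summable_abs
  have hsum : ∑' γ, v γ * χ γ = 0 := by
    simpa [hv, χ, ← hY] using key.symm
  have hFsum : ∑ γ ∈ F, v γ * χ γ = v γ₀ := by
    rw [Finset.sum_eq_single_of_mem γ₀ hγ₀]
    · simp [χ]
    · intro γ hγ hne'
      have : (γ : Γ ⧸ N.toSubgroup) ≠ γ₀ := fun h =>
        hne' (hN γ hγ (QuotientGroup.eq.1 h.symm))
      simp [χ, this]
  rw [← hg.of_abs.sum_add_tsum_subtype_compl F, hFsum] at hsum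
  have htail : ‖∑' γ : {γ // γ ∉ F}, v γ * χ γ‖ ≤ ∑' γ : {γ // γ ∉ F}, |v γ| :=
    tsum_of_norm_bounded
      (v.summable_abs.comp_injective (i := fun γ : {γ // γ ∉ F} => (γ : Γ))
        Subtype.val_injective).hasSum fun γ => hχ (γ : Γ)
  rw [(eq_neg_of_add_eq_zero_right hsum), norm_neg] at htail
  exact absurd hF (not_lt.2 htail)

end Convolution

/-! ### Inverting `f` and finding a point of `X_f` with a summable lift. -/

section Inverse

variable {Γ : Type*} [Group Γ]

/-- If `Γ` is residually finite and `ρ_f` is injective on bounded functions, then `f` is invertible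
in `ℓ¹(Γ)`. -/
theorem BoundedInjective.exists_inverse [Group.ResiduallyFinite Γ] [DecidableEq Γ]
    {f : MonoidAlgebra ℤ Γ} (hf : BoundedInjective f) :
    ∃ w : EllOne Γ, rconv f w = lp.single 1 1 1 ∧ lconv f w = lp.single 1 1 1 := by
  obtain ⟨w, hw⟩ := hf.rconv_surjective (lp.single 1 1 1)
  -- `(f * w - 1) * f = f * (w * f) - f = 0`, and right convolution by `f` is injective.
  refine ⟨w, hw, sub_eq_zero.1 (hf.eq_zero_of_rconv_eq_zero ?_)⟩
  rw [map_sub, ← lconv_rconv, hw, lconv_single_one, sub_self]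

theorem sum_zsmul_coe (f : MonoidAlgebra ℤ Γ) (y : Γ → ℝ) (γ : Γ) :
    ∑ γ' ∈ f.coeff.support, f.coeff γ' • ((y (γ * γ') : ℝ) : UnitAddCircle) =
      ((∑ γ' ∈ f.coeff.support, (f.coeff γ' : ℝ) * y (γ * γ') : ℝ) : UnitAddCircle) := by
  have := map_sum (QuotientAddGroup.mk' (AddSubgroup.zmultiples (1 : ℝ)))
    (fun γ' => (f.coeff γ' : ℝ) * y (γ * γ')) f.coeff.support
  refine Eq.trans (Finset.sum_congr rfl fun γ' _ => ?_) this.symm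
  rw [← zsmul_eq_mul]
  rfl

theorem norm_coe_le_abs (t : ℝ) : ‖(t : UnitAddCircle)‖ ≤ |t| :=
  QuotientAddGroup.norm_mk_le_norm

theorem boundedInjective_of_isExpansive {f : MonoidAlgebra ℤ Γ} (hf : IsExpansive (alpha f)) :
    BoundedInjective f := by
  intro y M hM hy
  obtain ⟨U, hUo, hU0, hU⟩ := hf
  obtain ⟨V, hV, hVU⟩ := mem_nhds_induced _ _ _ |>.1 (hUo.mem_nhds hU0)
  rw [ZeroMemClass.coe_zero, nhds_pi, Filter.mem_pi] at hV
  obtain ⟨I, hI, t, ht, hIV⟩ := hV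
  obtain ⟨ε, hε, hball⟩ := Metric.mem_nhds_iff.1 ((biInter_mem hI).2 fun i _ => ht i)
  -- After scaling, `ε` keeps every translate inside `U`, while `1/2` ensures that a value which is
  -- an integer must be `0`.
  have hm : 0 < min ε (1 / 2) := by positivity
  have hM1 : 0 < |M| + 1 := by positivity
  set s : ℝ := min ε (1 / 2) / (|M| + 1) with hs
  have hs0 : 0 < s := by positivity
  have hsy : ∀ γ, |s * y γ| < min ε (1 / 2) := fun γ => by
    rw [abs_mul, abs_of_pos hs0]
    calc s * |y γ| < s * (|M| + 1) := by
          gcongr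
          exact ((hM γ).trans (le_abs_self M)).trans_lt (lt_add_one _)
      _ = min ε (1 / 2) := by rw [hs]; field_simp
  let x : X f := ⟨fun γ => ((s * y γ : ℝ) : UnitAddCircle), by
    rw [mem_X_iff]
    intro γ
    rw [sum_zsmul_coe f (fun γ => s * y γ)]
    have : ∑ γ' ∈ f.coeff.support, (f.coeff γ' : ℝ) * (s * y (γ * γ')) = 0 := by
      rw [← mul_zero s, ← hy γ, Finset.mul_sum]
      exact Finset.sum_congr rfl fun _ _ => by ring
    rw [this]
    rfl⟩
  have hx : x ∈ ⋂ γ : Γ, ((alpha f).act γ) '' U := by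
    refine Set.mem_iInter.2 fun γ => ⟨(alpha f).act γ⁻¹ x, hVU (hIV fun i hi => ?_), ?_⟩
    · have hmem : ((s * y (γ⁻¹⁻¹ * i) : ℝ) : UnitAddCircle) ∈ Metric.ball 0 ε := by
        rw [mem_ball_zero_iff]
        exact (norm_coe_le_abs _).trans_lt ((hsy _).trans_le (min_le_left _ _))
      exact Set.mem_iInter₂.1 (hball hmem) i hi
    · rw [← (alpha f).map_mul, mul_inv_cancel, (alpha f).map_one]
  rw [hU] at hx
  funext γ
  have h0 : ((s * y γ : ℝ) : UnitAddCircle) = 0 :=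
    congrFun (congrArg Subtype.val (Set.mem_singleton_iff.1 hx)) γ
  obtain ⟨n, hn⟩ := (AddCircle.coe_eq_zero_iff 1).1 h0
  rw [zsmul_eq_mul, mul_one] at hn
  have h1 : |(n : ℝ)| < 1 := by
    rw [hn]
    exact (hsy γ).trans_le ((min_le_right _ _).trans (by norm_num))
  have hn0 : n = 0 := Int.abs_lt_one_iff.1 (by exact_mod_cast h1)
  rw [hn0, Int.cast_zero] at hn
  exact (mul_eq_zero.1 hn.symm).resolve_left hs0.ne'

/-- If `f` has a left inverse in `ℤΓ`, then `X_f = 0`. -/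
theorem X_eq_bot_of_mul_eq_one {f a : MonoidAlgebra ℤ Γ} (h : a * f = 1) : X f = ⊥ := by
  rw [eq_bot_iff]
  intro x hx
  rw [mem_X_iff] at hx
  rw [AddSubgroup.mem_bot]
  funext γ
  -- `Φ g = (ρ_g x)_γ` vanishes on the left ideal `ℤΓ f`, while `Φ 1 = x_γ`.
  let Φ : MonoidAlgebra ℤ Γ →+ UnitAddCircle :=
    { toFun := fun g => g.coeff.sum fun η n => n • x (γ * η)
      map_zero' := by simp
      map_add' := fun g g' => by
        rw [MonoidAlgebra.coeff_add]
        exact Finsupp.sum_add_index' (by simp) fun _ _ _ => add_smul _ _ _ }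
  have hsingle : ∀ η n, Φ (MonoidAlgebra.single η n) = n • x (γ * η) := fun η n => by
    change (Finsupp.single η n).sum (fun η n => n • x (γ * η)) = _
    simp
  have hmul : ∀ a : MonoidAlgebra ℤ Γ, Φ (a * f) = 0 := fun a => by
    induction a using MonoidAlgebra.induction_linear with
    | zero => simp
    | add a b ha hb => rw [add_mul, map_add, ha, hb, add_zero]
    | single η n =>
      have : f = ∑ γ' ∈ f.coeff.support, MonoidAlgebra.single γ' (f.coeff γ') :=
        (MonoidAlgebra.sum_coeff_single f).symm
      rw [this, Finset.mul_sum, map_sum]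
      simp only [MonoidAlgebra.single_mul_single, hsingle, mul_smul, ← Finset.smul_sum,
        ← mul_assoc]
      rw [hx, smul_zero]
  have := hmul a
  rw [h, MonoidAlgebra.one_def, hsingle, one_smul, mul_one] at this
  exact this

/-- If `X_f ≠ 0` and `α_f` is expansive, then `X_f` has a nonzero point with a lift in `ℓ¹`. -/
theorem exists_summable_point [Group.ResiduallyFinite Γ] {f : MonoidAlgebra ℤ Γ}
    (hX : X f ≠ ⊥) (hf : IsExpansive (alpha f)) :
    ∃ (x : X f) (y : EllOne Γ), (∀ γ, x.1 γ = ((y γ : ℝ) : UnitAddCircle)) ∧ x.1 1 ≠ 0 := by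
  classical
  obtain ⟨w, hw, hw'⟩ := (boundedInjective_of_isExpansive hf).exists_inverse
  by_cases hint : ∀ γ, ∃ n : ℤ, (n : ℝ) = w γ
  · exfalso
    choose n hn using hint
    -- Summable coefficients are eventually smaller than 1 in absolute value, and integers of that
    -- size are 0.
    have hfin : n.support.Finite := by
      have := (tendsto_order.1 (tendsto_zero_iff_norm_tendsto_zero.1
        w.summable.tendsto_cofinite_zero)).2 1 one_pos
      refine this.subset fun γ hγ (h : ‖w γ‖ < 1) => hγ ?_
      rw [Real.norm_eq_abs] at h
      simp only [← hn] at h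
      exact Int.abs_lt_one_iff.1 (by exact_mod_cast h)
    let a : MonoidAlgebra ℤ Γ := ⟨Finsupp.ofSupportFinite n hfin⟩
    have ha : ∀ γ, (a.coeff γ : ℝ) = w γ := hn
    refine hX (X_eq_bot_of_mul_eq_one (a := a) ?_)
    ext δ
    have hδ : ((a * f).coeff δ : ℝ) = rconv f w δ := by
      rw [rconv_apply]
      conv_lhs => rw [(MonoidAlgebra.sum_coeff_single f).symm]
      simp [Finsupp.sum, Finset.mul_sum, MonoidAlgebra.coeff_sum, Finsupp.finsetSum_apply, ha,
        mul_comm]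
    have h1 : ((1 : MonoidAlgebra ℤ Γ).coeff δ : ℝ) =
        lp.single (E := fun _ : Γ => ℝ) 1 1 1 δ := by
      rw [MonoidAlgebra.one_def, MonoidAlgebra.coeff_single, Finsupp.single_apply, lp.single_apply,
        Pi.single_apply]
      simp only [eq_comm (a := δ)]
      split_ifs <;> simp
    rw [hw, ← h1] at hδ
    exact_mod_cast hδ
  · push Not at hint
    obtain ⟨γ₀, hγ₀⟩ := hint
    -- Inversion turns `ρ_f` into left convolution by `f`, so `ρ_f y` takes only the values 0 and 1;
    -- the factor `γ₀` moves the non-integer coefficient to the identity.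
    let y : EllOne Γ := reindex ((Equiv.inv Γ).trans (Equiv.mulRight γ₀)) w
    have hy : ∀ γ, y γ = w (γ⁻¹ * γ₀) := fun γ => rfl
    refine ⟨⟨fun γ => ((y γ : ℝ) : UnitAddCircle), ?_⟩, y, fun _ => rfl, fun h => ?_⟩
    · rw [mem_X_iff]
      intro γ
      rw [sum_zsmul_coe f y]
      have h : ∑ γ' ∈ f.coeff.support, (f.coeff γ' : ℝ) * y (γ * γ') =
          lconv f w (γ⁻¹ * γ₀) := by
        rw [lconv_apply]
        simp [hy, mul_assoc]
      rw [h, hw', lp.single_apply, Pi.single_apply]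
      split_ifs
      exacts [AddCircle.coe_period 1, rfl]
    · obtain ⟨n, hn⟩ := (AddCircle.coe_eq_zero_iff 1).1 h
      refine hγ₀ n ?_
      simpa [hy] using hn

end Inverse

/-! ### Separated sets from sums of translates. -/

section Separated

variable {Γ : Type*} [Group Γ]

/-- For a maximal such `D`, no further point of `Q` can be added, so `Q ⊆ (F ∪ F⁻¹) D`; `1 ∈ F`
covers the points of `D` itself. -/
theorem exists_separated_subset [DecidableEq Γ] (F Q : Finset Γ) (hF : 1 ∈ F) :
    ∃ D ⊆ Q, (∀ p ∈ D, ∀ q ∈ D, p ≠ q → p * q⁻¹ ∉ F) ∧ Q.card ≤ (F ∪ F⁻¹).card * D.card := by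
  obtain ⟨D, hD⟩ := (Q.powerset.filter fun D =>
    ∀ p ∈ D, ∀ q ∈ D, p ≠ q → p * q⁻¹ ∉ F).exists_maximal ⟨∅, by simp⟩
  have hDmem := hD.prop
  rw [Finset.mem_filter, Finset.mem_powerset] at hDmem
  refine ⟨D, hDmem.1, hDmem.2, ?_⟩
  refine (Finset.card_le_card fun q hq => ?_).trans (Finset.card_mul_le (s := F ∪ F⁻¹) (t := D))
  by_contra hmul
  have hno : ∀ d ∈ D, q * d⁻¹ ∉ F ∪ F⁻¹ := fun d hd h =>
    hmul (Finset.mem_mul.2 ⟨_, h, d, hd, by simp⟩)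
  have hins : insert q D ∈ Q.powerset.filter fun D => ∀ p ∈ D, ∀ q ∈ D, p ≠ q → p * q⁻¹ ∉ F := by
    rw [Finset.mem_filter, Finset.mem_powerset]
    refine ⟨Finset.insert_subset hq hDmem.1, fun p hp p' hp' hne h => ?_⟩
    rcases Finset.mem_insert.1 hp with rfl | hpD <;> rcases Finset.mem_insert.1 hp' with rfl | hpD'
    · exact hne rfl
    · exact hno p' hpD' (Finset.mem_union_left _ h)
    · refine hno p hpD (Finset.mem_union_right _ ?_)
      simpa using h
    · exact hDmem.2 p hpD p' hpD' hne h
  have hqD : q ∈ D := hD.le_of_ge hins (Finset.subset_insert q D) (Finset.mem_insert_self q D)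
  exact hno q hqD (by simp [hF])

/-- The neighbourhood `{z : ‖z₁‖ < r}` of `0` in `X_f`. -/
def coordBall (f : MonoidAlgebra ℤ Γ) (r : ℝ) : Set (X f) := {z | ‖z.1 1‖ < r}

theorem coordBall_mem_nhds (f : MonoidAlgebra ℤ Γ) {r : ℝ} (hr : 0 < r) :
    coordBall f r ∈ 𝓝 (0 : X f) := by
  refine IsOpen.mem_nhds ?_ (by simpa [coordBall] using hr)
  exact isOpen_lt ((continuous_apply 1).comp continuous_subtype_val).norm continuous_const

/-- Each `A ⊆ D` gives the point `P A`, the sum of the `q⁻¹`-translates of `x` over `q ∈ A`. If `q`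
lies in just one of `A` and `B`, acting by `q` brings the term `± x_1` to the identity coordinate of
the difference, and by `hD` the other terms cannot reduce its norm below `r`. -/
theorem two_pow_le_sepNumber [DecidableEq Γ] {f : MonoidAlgebra ℤ Γ} (x : X f) {r : ℝ} (hr : 0 < r)
    {Q D : Finset Γ} (hDQ : D ⊆ Q)
    (hD : ∀ q ∈ D, ∑ p ∈ D with p ≠ q, ‖x.1 (p * q⁻¹)‖ + r ≤ ‖x.1 1‖) :
    ((2 ^ D.card : ℕ) : ℕ∞) ≤ sepNumber (alpha f) Q (coordBall f r) := by
  let P : Finset Γ → X f := fun A => ∑ q ∈ A, (alpha f).act q⁻¹ x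
  have hP : ∀ A γ, ((alpha f).act γ (P A)).1 1 = ∑ p ∈ A, x.1 (p * γ⁻¹) := fun A γ => by
    simp only [P, map_sum, AddSubgroup.val_finsetSum, Finset.sum_apply]
    exact Finset.sum_congr rfl fun p _ => by simp [alpha, shift]
  have hsub : ∀ A ⊆ D, ∀ B ⊆ D, ∀ q ∈ A, q ∉ B →
      r ≤ ‖((alpha f).act q (P A) - (alpha f).act q (P B)).1 1‖ := by
    intro A hA B hB q hqA hqB
    let e : Γ → UnitAddCircle := fun p =>
      (if p ∈ A then x.1 (p * q⁻¹) else 0) - (if p ∈ B then x.1 (p * q⁻¹) else 0)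
    have he : ((alpha f).act q (P A) - (alpha f).act q (P B)).1 1 = ∑ p ∈ D, e p := by
      rw [AddSubgroup.coe_sub, Pi.sub_apply, hP, hP, Finset.sum_sub_distrib, Finset.sum_ite_mem,
        Finset.sum_ite_mem, Finset.inter_eq_right.2 hA, Finset.inter_eq_right.2 hB]
    have hnorm : ∀ p, ‖e p‖ ≤ ‖x.1 (p * q⁻¹)‖ := fun p => by
      by_cases h1 : p ∈ A <;> by_cases h2 : p ∈ B <;> simp [e, h1, h2]
    have heq : e q = x.1 1 := by simp [e, hqA, hqB]
    rw [he, ← Finset.add_sum_erase D e (hA hqA), heq]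
    have h1 : ‖∑ p ∈ D.erase q, e p‖ ≤ ∑ p ∈ D with p ≠ q, ‖x.1 (p * q⁻¹)‖ := by
      rw [Finset.filter_ne']
      exact norm_sum_le_of_le _ fun p _ => hnorm p
    have h2 := norm_sub_le_norm_add (x.1 1) (∑ p ∈ D.erase q, e p)
    have h3 := hD q (hA hqA)
    linarith
  have hsep : ∀ A ⊆ D, ∀ B ⊆ D, A ≠ B →
      ∃ γ ∈ Q, (alpha f).act γ (P A) - (alpha f).act γ (P B) ∉ coordBall f r := by
    intro A hA B hB hne
    by_cases hAB : A ⊆ B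
    · obtain ⟨q, hqB, hqA⟩ := Finset.not_subset.1 fun h => hne (hAB.antisymm h)
      refine ⟨q, hDQ (hB hqB), fun h : ‖(_ : X f).1 1‖ < r => absurd h (not_lt.2 ?_)⟩
      have := hsub B hB A hA q hqB hqA
      rwa [← neg_sub, NegMemClass.coe_neg, Pi.neg_apply, norm_neg] at this
    · obtain ⟨q, hqA, hqB⟩ := Finset.not_subset.1 hAB
      exact ⟨q, hDQ (hA hqA), fun h : ‖(_ : X f).1 1‖ < r =>
        absurd h (not_lt.2 (hsub A hA B hB q hqA hqB))⟩
  have hinj : Set.InjOn P (D.powerset : Set (Finset Γ)) := by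
    intro A hA B hB hPAB
    by_contra hne
    obtain ⟨γ, -, hγ⟩ := hsep A (by simpa using hA) B (by simpa using hB) hne
    rw [hPAB, sub_self] at hγ
    exact hγ (mem_of_mem_nhds (coordBall_mem_nhds f hr))
  have hS : IsSeparated (alpha f) Q (coordBall f r) (P '' D.powerset) := by
    rintro _ ⟨A, hA, rfl⟩ _ ⟨B, hB, rfl⟩ hne
    exact hsep A (by simpa using hA) B (by simpa using hB) fun h => hne (congrArg P h)
  refine le_trans (le_of_eq ?_) (le_iSup₂ (f := fun S _ => S.encard) _ hS)
  rw [hinj.encard_image, Set.encard_coe_eq_coe_finsetCard, Finset.card_powerset]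

variable {X : Type*} [AddCommGroup X] [TopologicalSpace X]
  [IsTopologicalAddGroup X] [CompactSpace X] [T2Space X]

/-- A bound uniform over nonempty `Q` passes to the lower limit, because Følner sets are nonempty.
-/
theorem le_entropy_of_two_pow_le (α : AlgebraicAction Γ X) {U : Set X} (hU : U ∈ 𝓝 0) {c : ℝ}
    (h : ∀ Q : Finset Γ, Q.Nonempty →
      ∃ k : ℕ, ((2 ^ k : ℕ) : ℕ∞) ≤ sepNumber α Q U ∧ c * Q.card ≤ k * Real.log 2) :
    (c : EReal) ≤ entropy α := by
  refine le_trans ?_ (le_iSup₂ (f := fun U (_ : U ∈ 𝓝 (0 : X)) => sepEntropy α U) U hU)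
  -- Invariance under `K = ∅` with `ε = 1` already includes nonemptiness.
  have hne : ∀ᶠ Q in folnerFilter Γ, Q.Nonempty := by
    refine Filter.mem_of_superset (mem_iInf_of_mem ∅ (mem_iInf_of_mem 1
      (mem_iInf_of_mem one_pos (mem_principal_self _)))) fun Q hQ => hQ.1
  refine le_liminf_of_le (by isBoundedDefault) (hne.mono fun Q hQ => ?_)
  obtain ⟨k, hk, hc⟩ := h Q hQ
  have hlog : ((k * Real.log 2 : ℝ) : EReal) ≤ ENNReal.log (sepNumber α Q U : ENNReal) := by
    have h1 : ((2 ^ k : ℕ) : ENNReal) ≤ (sepNumber α Q U : ENNReal) := by exact_mod_cast hk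
    refine le_trans (le_of_eq ?_) (ENNReal.log_monotone h1)
    rw [Nat.cast_pow, ENNReal.log_pow, ENNReal.log_pos_real (by simp) (by simp)]
    simp
  have hQ0 : (0 : ℝ) < Q.card := by exact_mod_cast hQ.card_pos
  rw [EReal.le_div_iff_mul_le (by exact_mod_cast hQ.card_pos) (EReal.natCast_ne_top _)]
  refine le_trans ?_ hlog
  exact_mod_cast hc

end Separated

end

end AlgAct

namespace AlgAct

/-! ### Entropy bounds and indices of the subgroups. -/

section Positivity

variable {Γ : Type*} [Group Γ]

/-- A nonzero point of `X_f` with a lift in `ℓ¹(Γ)` forces positive entropy. -/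
theorem exists_pos_le_entropy {f : MonoidAlgebra ℤ Γ} (x : X f) (y : EllOne Γ)
    (hxy : ∀ γ, x.1 γ = ((y γ : ℝ) : UnitAddCircle)) (hx : x.1 1 ≠ 0) :
    ∃ c : ℝ, 0 < c ∧ (c : EReal) ≤ entropy (alpha f) := by
  classical
  -- Half of `‖x_1‖` is spent on the tail of `y`; the other half is the separation radius.
  have hr : 0 < ‖x.1 1‖ / 2 := half_pos (norm_pos_iff.2 hx)
  obtain ⟨F, hF1, hF⟩ := y.exists_tail_lt 1 hr
  have hk : (0 : ℝ) < (F ∪ F⁻¹).card := by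
    exact_mod_cast Finset.card_pos.2 ⟨1, Finset.mem_union_left _ hF1⟩
  have hlog : 0 < Real.log 2 := Real.log_pos one_lt_two
  refine ⟨Real.log 2 / (F ∪ F⁻¹).card, by positivity,
    le_entropy_of_two_pow_le _ (coordBall_mem_nhds f hr) fun Q _ => ?_⟩
  obtain ⟨D, hDQ, hD, hcard⟩ := exists_separated_subset F Q hF1
  refine ⟨D.card, two_pow_le_sepNumber x hr hDQ fun q hq => ?_, ?_⟩
  · have hsum : ∑ p ∈ D with p ≠ q, ‖x.1 (p * q⁻¹)‖ ≤ ∑' γ : {γ // γ ∉ F}, |y γ| := by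
      let i : {p // p ∈ D.filter (· ≠ q)} → {γ // γ ∉ F} := fun p =>
        ⟨p.1 * q⁻¹, hD p.1 (Finset.mem_filter.1 p.2).1 q hq (Finset.mem_filter.1 p.2).2⟩
      have hi : Function.Injective i := fun a b h =>
        Subtype.ext (mul_right_cancel (congrArg Subtype.val h))
      have hs : Summable fun γ : {γ // γ ∉ F} => |y γ| :=
        y.summable_abs.comp_injective (i := fun γ : {γ // γ ∉ F} => (γ : Γ)) Subtype.val_injective
      calc ∑ p ∈ D with p ≠ q, ‖x.1 (p * q⁻¹)‖
          ≤ ∑ p ∈ D with p ≠ q, |y (p * q⁻¹)| :=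
            Finset.sum_le_sum fun p _ => by rw [hxy]; exact norm_coe_le_abs _
        _ = ∑ p ∈ (D.filter (· ≠ q)).attach, |y (i p)| :=
            (Finset.sum_attach _ fun p => |y (p * q⁻¹)|).symm
        _ = ∑ γ ∈ (D.filter (· ≠ q)).attach.map ⟨i, hi⟩, |y γ| := by simp
        _ ≤ _ := hs.sum_le_tsum _ fun _ _ => abs_nonneg _
    linarith
  · rw [div_mul_eq_mul_div, div_le_iff₀ hk, mul_comm (Real.log 2), mul_right_comm]
    gcongr
    exact_mod_cast hcard.trans_eq (mul_comm _ _)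

/-- For a finite group, two points of `X_f` already give entropy at least `|Γ|⁻¹ log 2`. -/
theorem log_two_div_card_le_entropy [Finite Γ] {f : MonoidAlgebra ℤ Γ} (x : X f)
    (hx : x.1 1 ≠ 0) : (((Nat.card Γ : ℝ)⁻¹ * Real.log 2 : ℝ) : EReal) ≤ entropy (alpha f) := by
  classical
  have := Fintype.ofFinite Γ
  -- A singleton `D` has no interfering terms, so the full radius `‖x_1‖` is available, and `|Q| ≤
  -- |Γ|` gives the rate.
  refine le_entropy_of_two_pow_le _ (coordBall_mem_nhds f (norm_pos_iff.2 hx)) fun Q hQ => ?_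
  obtain ⟨q, hq⟩ := hQ
  refine ⟨1, ?_, ?_⟩
  · have := two_pow_le_sepNumber x (norm_pos_iff.2 hx) (D := {q}) (Q := Q) (by simpa using hq)
      (by simp [Finset.filter_singleton])
    simpa using this
  · have hcard : (Q.card : ℝ) ≤ Nat.card Γ := by
      rw [Nat.card_eq_fintype_card]
      exact_mod_cast Q.card_le_univ
    have h0 : (0 : ℝ) < Nat.card Γ := by exact_mod_cast Nat.card_pos
    have hlog : 0 < Real.log 2 := Real.log_pos one_lt_two
    rw [mul_right_comm, inv_mul_eq_div, Nat.cast_one]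
    gcongr
    exact (div_le_one h0).2 hcard

/-- If `Γₙ → {1}`, then every finite subset of `Γ` embeds into `Γ/Γₙ` for all large `n`. -/
theorem TendsToTrivial.eventually_card_le_index {G : ℕ → Subgroup Γ} (hG : TendsToTrivial G)
    (hfin : ∀ n, (G n).FiniteIndex) (K : Finset Γ) : ∀ᶠ n in atTop, K.card ≤ (G n).index := by
  obtain ⟨N, hN⟩ := hG K
  filter_upwards [eventually_ge_atTop N] with n hn
  have := hfin n
  have hinj : Function.Injective fun k : K => ((k : Γ) : Γ ⧸ G n) := fun a b hab => by
    have hmem : (a : Γ)⁻¹ * b ∈ (G n : Set Γ) ∩ ((K : Set Γ)⁻¹ * (K : Set Γ)) :=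
      ⟨QuotientGroup.eq.1 hab, Set.mul_mem_mul (by simp) (by simp)⟩
    exact Subtype.ext (inv_mul_eq_one.1 (hN n hn hmem))
  simpa [Subgroup.index] using Nat.card_le_card_of_injective _ hinj

end Positivity

end AlgAct

theorem theoremt {Γ : Type*} [Group Γ] [Countable Γ] [Group.ResiduallyFinite Γ]
    (hΓ : AlgAct.IsAmenable Γ) (f : MonoidAlgebra ℤ Γ)
    (hX : AlgAct.X f ≠ ⊥) (hf : AlgAct.IsExpansive (AlgAct.alpha f)) :
    0 < AlgAct.entropy (AlgAct.alpha f) ∧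
      ∀ G : ℕ → Subgroup Γ, (∀ n, (G n).Normal) → (∀ n, (G n).FiniteIndex) →
        AlgAct.TendsToTrivial G →
        ∀ᶠ n in atTop,
          (((G n).index : ℝ)⁻¹ * Real.log 2 : ℝ) ≤ AlgAct.entropy (AlgAct.alpha f) := by
  obtain ⟨x, y, hxy, hx⟩ := AlgAct.exists_summable_point hX hf
  obtain ⟨c, hc, hle⟩ := AlgAct.exists_pos_le_entropy x y hxy hx
  have hlog : 0 < Real.log 2 := Real.log_pos one_lt_two
  refine ⟨lt_of_lt_of_le (by exact_mod_cast hc) hle, fun G _ hfin hG => ?_⟩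
  -- For finite `Γ` the index stays bounded and `c` may be too small, so the direct bound is used;
  -- for infinite `Γ` the index eventually exceeds `log 2 / c`.
  rcases finite_or_infinite Γ with hfinite | hinfinite
  · have := Fintype.ofFinite Γ
    filter_upwards [hG.eventually_card_le_index hfin Finset.univ] with n hn
    refine le_trans (EReal.coe_le_coe_iff.2 ?_) (AlgAct.log_two_div_card_le_entropy x hx)
    have h0 : (0 : ℝ) < Nat.card Γ := by exact_mod_cast Nat.card_pos
    gcongr
    rwa [Nat.card_eq_fintype_card]
  · obtain ⟨m, hm⟩ := exists_nat_ge (Real.log 2 / c)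
    obtain ⟨K, hK⟩ := Infinite.exists_subset_card_eq Γ m
    filter_upwards [hG.eventually_card_le_index hfin K] with n hn
    refine le_trans (EReal.coe_le_coe_iff.2 ?_) hle
    have := hfin n
    have h0 : (0 : ℝ) < (G n).index := by
      exact_mod_cast Nat.pos_of_ne_zero Subgroup.FiniteIndex.index_ne_zero
    rw [inv_mul_eq_div, div_le_iff₀ h0, mul_comm, ← div_le_iff₀ hc]
    exact hm.trans (by exact_mod_cast hK ▸ hn)
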